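/- Let $(\mathcal U,\delta)$ be a differentially closed field of characteristic $0$ and let $K\subseteq\mathcal U$ be an algebraically closed differential subfield. Consider a differential algebraic equation $P(T)=0$ over $K$, that is, $P=Q/R$ where $Q,R\in K\{T\}$ are differential polynomials with $R\neq 0$ and $\operatorname{ord}(R)<\operatorname{ord}(Q)$ (the order of a differential polynomial is the largest $i$ such that $T^{(i)}$ occurs in it, and $-\infty$ for a constant polynomial). Let $n=\operatorname{ord}(Q)$ be the order of the equation; a solution is an element $a\in\mathcal U$ with $Q(a)=0\neq R(a)$. Assume that $n\ge 1$, that the equation is irreducible over $K$ (that is, $Q$ is irreducible as a multivariate polynomial), and that it has Property D$_2$: for any two distinct solutions $a_1\neq a_2$ in $\mathcal U$, neither of them algebraic over $K$, the elements $$a_1,\delta(a_1),\dots,\delta^{n-1}(a_1),\;a_2,\delta(a_2),\dots,\delta^{n-1}(a_2)$$ form an algebraically independent family over $K$. Then the generic type of the equation over $K$, that is, the type over $K$ of a solution that is not algebraic over $K$, is weakly orthogonal to the constants: for every solution $a\in\mathcal U$ that is not algebraic over $K$, the differential field $K\langle a\rangle$ generated by $a$ over $K$ contains no new constants, i.e.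 $$\{x\in K\langle a\rangle : \delta(x)=0\}=\{x\in K:\delta(x)=0\}.$$ (The type of $a$ over $K$ is the set of all $b\in\mathcal U$ at which exactly the same differential polynomials over $K$ vanish as at $a$.) -/

import Mathlib

namespace DiffAlg

universe u v

/-- The order of a differential polynomial.  The ring `K{T}` of differential polynomials in one
differential variable is `MvPolynomial ℕ K`, the variable of index `i` standing for `T^(i)`.  The
order is the largest `i` such that `T^(i)` occurs, and `⊥` for a constant polynomial. -/
noncomputable def diffOrd {K : Type u} [CommRing K] (P : MvPolynomial ℕ K) : WithBot ℕ :=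
  P.vars.max

/-- Evaluation `P(T) ↦ P(a, δ a, δ² a, …)` of differential polynomials over `K` at an element `a`
of a differential ring over `K`. -/
noncomputable def diffEval (K : Type u) {U : Type v} [CommRing K] [CommRing U] [Differential U]
    [Algebra K U] (a : U) : MvPolynomial ℕ K →ₐ[K] U :=
  MvPolynomial.aeval (fun i : ℕ => (Differential.deriv : U → U)^[i] a)

/-- A differential field `U` is differentially closed if for all nonzero differential polynomials
`P` and `Q` over `U` with `ord Q < ord P` there is `a` in `U` with `P(a) = 0 ≠ Q(a)`. -/
def IsDifferentiallyClosed (U : Type v) [Field U] [Differential U] : Prop :=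
  ∀ P Q : MvPolynomial ℕ U, P ≠ 0 → Q ≠ 0 → diffOrd Q < diffOrd P →
    ∃ a : U, diffEval U a P = 0 ∧ diffEval U a Q ≠ 0

/-- The differential field `K⟨a⟩` generated by `a` over `K`: it is generated, as a field
extension of `K`, by `a` and all its derivatives. -/
noncomputable def diffAdjoin (K : Type u) {U : Type v} [Field K] [Field U] [Differential U]
    [Algebra K U] (a : U) : IntermediateField K U :=
  IntermediateField.adjoin K (Set.range (fun i : ℕ => (Differential.deriv : U → U)^[i] a))

/-- `K⟨a⟩` is closed under the derivation. -/
theorem deriv_mem_diffAdjoin (K : Type u) {U : Type v} [Field K] [Differential K] [Field U]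
    [Differential U] [Algebra K U] [DifferentialAlgebra K U] (a : U) {x : U}
    (hx : x ∈ diffAdjoin K a) : Differential.deriv x ∈ diffAdjoin K a := by
  unfold diffAdjoin at hx ⊢
  induction hx using IntermediateField.adjoin_induction with
  | mem x hx =>
    obtain ⟨i, rfl⟩ := hx
    refine IntermediateField.subset_adjoin K _ ⟨i + 1, ?_⟩
    exact Function.iterate_succ_apply' _ _ _
  | algebraMap k =>
    rw [deriv_algebraMap]
    exact IntermediateField.algebraMap_mem _ _
  | add x y _ _ h1 h2 =>
    rw [map_add]
    exact add_mem h1 h2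
  | inv x hx h1 =>
    rw [Derivation.leibniz_inv]
    exact mul_mem (neg_mem (pow_mem (inv_mem hx) 2)) h1
  | mul x y hx hy h1 h2 =>
    rw [Derivation.leibniz]
    exact add_mem (mul_mem hx h2) (mul_mem hy h1)

/-- `K⟨a⟩` is the least field between `K` and `U` that contains `a` and is closed under the
derivation. -/
theorem diffAdjoin_le (K : Type u) {U : Type v} [Field K] [Field U] [Differential U]
    [Algebra K U] (a : U) (L : IntermediateField K U) (ha : a ∈ L)
    (hL : ∀ x ∈ L, Differential.deriv x ∈ L) : diffAdjoin K a ≤ L := by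
  unfold diffAdjoin
  rw [IntermediateField.adjoin_le_iff]
  rintro _ ⟨i, rfl⟩
  induction i with
  | zero => exact ha
  | succ i ih =>
    simp only [Function.iterate_succ_apply']
    exact hL _ ih

/-- The ideal `I(a/K)` of all differential polynomials over `K` that vanish at `a`. -/
noncomputable def vanishingIdeal (K : Type u) {U : Type v} [CommRing K] [CommRing U]
    [Differential U] [Algebra K U] (a : U) : Ideal (MvPolynomial ℕ K) :=
  RingHom.ker (diffEval K a)

/-- The type `tp(a/K)`, as the set of its realizations in `U`: the class of `a` for the relation
of having the same vanishing ideal over `K`. -/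
def tp (K : Type u) {U : Type v} [CommRing K] [CommRing U] [Differential U] [Algebra K U]
    (a : U) : Set U :=
  {b : U | vanishingIdeal K b = vanishingIdeal K a}

/-- A type over `K`, given by its realizations in `U`, is weakly orthogonal to the constants if
every realization `a` satisfies `C_{K⟨a⟩} = C_K` (an equality of subsets of `U`). -/
def WeaklyOrthogonalToConstants (K : Type u) {U : Type v} [Field K] [Differential K] [Field U]
    [Differential U] [Algebra K U] (p : Set U) : Prop :=
  ∀ a ∈ p, {x : U | x ∈ diffAdjoin K a ∧ Differential.deriv x = 0} =
    algebraMap K U '' {k : K | Differential.deriv k = 0}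

/-- A differential algebraic (rational) equation `Q(T)/R(T) = 0` over `K`: a pair of differential
polynomials `Q = num` and `R = den` with `R ≠ 0` and `ord R < ord Q`. -/
structure DiffAlgEquation (K : Type u) [CommRing K] where
  num : MvPolynomial ℕ K
  den : MvPolynomial ℕ K
  den_ne_zero : den ≠ 0
  ord_den_lt : diffOrd den < diffOrd num

namespace DiffAlgEquation

/-- The order of the equation, i.e. the order of the numerator (which is not `⊥`, because it
exceeds the order of the denominator). -/
noncomputable def order {K : Type u} [CommRing K] (E : DiffAlgEquation K) : ℕ :=
  (diffOrd E.num).unbot (ne_bot_of_gt E.ord_den_lt)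

/-- The equation is irreducible over `K` if its numerator is, as a multivariate polynomial. -/
def IsIrreducible {K : Type u} [CommRing K] (E : DiffAlgEquation K) : Prop :=
  Irreducible E.num

/-- `a` is a solution of `Q(T)/R(T) = 0` if `Q(a) = 0 ≠ R(a)`. -/
def IsSolution {K : Type u} {U : Type v} [CommRing K] [CommRing U] [Differential U] [Algebra K U]
    (E : DiffAlgEquation K) (a : U) : Prop :=
  diffEval K a E.num = 0 ∧ diffEval K a E.den ≠ 0

/-- Property `D_m` (in `U`): for any `m` pairwise distinct solutions in `U`, none of them algebraic
over `K`, the solutions together with their derivatives of order less than the order of the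
equation form an algebraically independent family over `K`. -/
def PropertyD {K : Type u} [CommRing K] (E : DiffAlgEquation K) (U : Type v) [CommRing U]
    [Differential U] [Algebra K U] (m : ℕ) : Prop :=
  ∀ a : Fin m → U, Function.Injective a →
    (∀ i, E.IsSolution (a i) ∧ ¬ IsAlgebraic K (a i)) →
    AlgebraicIndependent K
      (fun q : Fin m × Fin E.order => (Differential.deriv : U → U)^[(q.2 : ℕ)] (a q.1))

/-- `p` is the generic type of the equation over `K`: the type over `K` of a solution in `U` that
is not algebraic over `K`. -/
def IsGenericType {K : Type u} {U : Type v} [CommRing K] [CommRing U] [Differential U]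
    [Algebra K U] (E : DiffAlgEquation K) (p : Set U) : Prop :=
  ∃ a : U, E.IsSolution a ∧ ¬ IsAlgebraic K a ∧ p = tp K a

end DiffAlgEquation

end DiffAlg

/-! Suppose `K⟨a⟩` contains a constant `c = f(a)/g(a)` outside `K`. As `K` is algebraically closed,
`c` is transcendental over `K`, and so is `c + 1`; since both are constants, `X ↦ c` and `X ↦ c + 1`
are two differential embeddings of `K[X]` in `U`. Differential closedness then yields a solution `b`
with `f(b)/g(b) = c + 1` (`exists_solution_of_transcendental_constant`). Thus `b ≠ a`, and `b` is
not algebraic over `K`, for otherwise `c + 1` would lie in `K`. Now `c` is algebraic over the first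
`n` derivatives of `a` and also over those of `b` (`isAlgebraic_of_mem_diffAdjoin`). By D₂ these two
families are jointly independent, so `c` is algebraic over `K`
(`isAlgebraic_of_algebraicIndependent`), a contradiction.

The main work is `exists_specialization`: the axiom of differential closedness handles one equation
and one inequation of lower order, so finitely many conditions on `b` must first be reduced to that
shape. -/

namespace DiffAlg

/-! ### Fraction-free division and minimal polynomials -/

open Polynomial in
theorem exists_pseudo_division {A : Type*} [CommRing A] [IsDomain A] {h : A[X]} (hh : h ≠ 0)
    (p : A[X]) : ∃ d : A, d ≠ 0 ∧ ∃ q r : A[X], C d * p = q * h + r ∧ r.degree < h.degree := by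
  have key : ∀ n : ℕ, ∀ p : A[X], p.degree < n →
      ∃ d : A, d ≠ 0 ∧ ∃ q r : A[X], C d * p = q * h + r ∧ r.degree < h.degree := by
    intro n
    induction n with
    | zero =>
      intro p hp
      have hp0 : p = 0 := by
        rw [← degree_eq_bot]
        simpa using hp
      exact ⟨1, one_ne_zero, 0, 0, by simp [hp0], by simpa [bot_lt_iff_ne_bot] using hh⟩
    | succ n ih =>
      intro p hp
      by_cases hlt : p.degree < h.degree
      · exact ⟨1, one_ne_zero, 0, p, by simp, hlt⟩
      push Not at hlt
      have hp0 : p ≠ 0 := by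
        rintro rfl
        simp [hh] at hlt
      have hnd : h.natDegree ≤ p.natDegree := natDegree_le_natDegree hlt
      have hlc : h.leadingCoeff ≠ 0 := leadingCoeff_ne_zero.mpr hh
      have hlp : p.leadingCoeff ≠ 0 := leadingCoeff_ne_zero.mpr hp0
      have hdeg : (C h.leadingCoeff * p -
          C p.leadingCoeff * X ^ (p.natDegree - h.natDegree) * h).degree < (C h.leadingCoeff * p).degree := by
        apply degree_sub_lt_left
        · rw [degree_C_mul hlc, mul_assoc, degree_C_mul hlp, degree_mul, degree_X_pow,
            degree_eq_natDegree hp0, degree_eq_natDegree hh]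
          norm_cast
          omega
        · exact mul_ne_zero (C_ne_zero.mpr hlc) hp0
        · rw [leadingCoeff_mul, leadingCoeff_mul, leadingCoeff_mul, leadingCoeff_X_pow,
            leadingCoeff_C, leadingCoeff_C]
          ring
      rw [degree_C_mul hlc] at hdeg
      obtain ⟨d, hd, q, r, e, hr⟩ := ih _ (lt_of_lt_of_le hdeg (Order.le_of_lt_succ
        (by rw [Nat.cast_succ] at hp; exact hp)))
      refine ⟨d * h.leadingCoeff, mul_ne_zero hd hlc,
        q + C d * (C p.leadingCoeff * X ^ (p.natDegree - h.natDegree)), r, ?_, hr⟩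
      rw [C_mul]
      linear_combination e
  exact key (p.natDegree + 1) p (by
    refine lt_of_le_of_lt degree_le_natDegree ?_
    exact_mod_cast Nat.lt_succ_self _)

open Polynomial in
/-- A fraction-free minimal polynomial of an algebraic element, together with fraction-free
versions of divisibility and of Bézout's identity. -/
theorem exists_pseudo_minpoly {A U : Type*} [CommRing A] [IsDomain A] [Field U] [CharZero U]
    {φ : A →+* U} (hφ : Function.Injective φ) {θ : U}
    (hθ : ∃ p : A[X], p ≠ 0 ∧ p.eval₂ φ θ = 0) :
    ∃ h : A[X], h.eval₂ φ θ = 0 ∧ h.derivative.eval₂ φ θ ≠ 0 ∧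
      (∀ p : A[X], p.eval₂ φ θ = 0 → ∃ d : A, d ≠ 0 ∧ ∃ q, C d * p = q * h) ∧
      (∀ p : A[X], p.eval₂ φ θ ≠ 0 → ∃ d : A, d ≠ 0 ∧ ∃ u v, C d = u * h + v * p) := by
  have : CharZero A := ⟨fun m n e => by
    have := congrArg φ e
    simpa using this⟩
  classical
  obtain ⟨h, ⟨hh, hz⟩, hmin⟩ := exists_minimalFor_of_wellFoundedLT
    (fun p : A[X] => p ≠ 0 ∧ p.eval₂ φ θ = 0) Polynomial.degree hθ
  have hmin' : ∀ p : A[X], p.eval₂ φ θ = 0 → p.degree < h.degree → p = 0 := by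
    intro p hp hlt
    by_contra hne
    exact absurd (hmin ⟨hne, hp⟩ hlt.le) (not_le.mpr hlt)
  have hdvd : ∀ p : A[X], p.eval₂ φ θ = 0 → ∃ d : A, d ≠ 0 ∧ ∃ q, C d * p = q * h := by
    intro p hp
    obtain ⟨d, hd, q, r, e, hr⟩ := exists_pseudo_division hh p
    refine ⟨d, hd, q, ?_⟩
    have hr0 : r.eval₂ φ θ = 0 := by
      have := congrArg (eval₂ φ θ) e
      simpa [eval₂_add, eval₂_mul, hp, hz] using this.symm
    rw [e, hmin' r hr0 hr, add_zero]
  refine ⟨h, hz, ?_, hdvd, ?_⟩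
  -- The derivative has smaller degree, so vanishing at `θ` would make it zero; in characteristic 0,
  -- `h` would then be a nonzero constant with a root.
  · intro h0
    have h1 := hmin' _ h0 (degree_derivative_lt hh)
    have h2 := derivative_eq_zero.mp h1
    rw [natDegree_eq_zero] at h2
    obtain ⟨c, rfl⟩ := h2
    rw [eval₂_C, map_eq_zero_iff φ hφ] at hz
    exact hh (by rw [hz, C_0])
  · intro p hp
    -- A nonzero `r` of least degree in the ideal `(h, p)` divides `h` and `p` up to constants. It
    -- cannot vanish at `θ`, so the cofactor of `h` does; minimality of `h` leaves `r` no degree.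
    obtain ⟨r, ⟨hr, hrI⟩, hrmin⟩ := exists_minimalFor_of_wellFoundedLT
      (fun r : A[X] => r ≠ 0 ∧ ∃ u v, r = u * h + v * p) Polynomial.degree
      ⟨h, hh, 1, 0, by ring⟩
    obtain ⟨u, v, hruv⟩ := hrI
    have hrdvd : ∀ w : A[X], (∃ u v, w = u * h + v * p) →
        ∃ d : A, d ≠ 0 ∧ ∃ q, C d * w = q * r := by
      rintro w ⟨u', v', hw⟩
      obtain ⟨d, hd, q, s, e, hs⟩ := exists_pseudo_division hr w
      refine ⟨d, hd, q, ?_⟩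
      have hs0 : s = 0 := by
        by_contra hne
        refine absurd (hrmin ⟨hne, C d * u' - q * u, C d * v' - q * v, ?_⟩ hs.le) (not_le.mpr hs)
        linear_combination -e + C d * hw - q * hruv
      rw [e, hs0, add_zero]
    obtain ⟨d, hd, q, e⟩ := hrdvd h ⟨1, 0, by ring⟩
    obtain ⟨d', hd', q', e'⟩ := hrdvd p ⟨0, 1, by ring⟩
    have hrθ : r.eval₂ φ θ ≠ 0 := by
      intro h0
      have := congrArg (eval₂ φ θ) e'
      rw [eval₂_mul, eval₂_mul, h0, mul_zero, eval₂_C, mul_eq_zero, map_eq_zero_iff φ hφ] at this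
      exact this.elim hd' hp
    have hqθ : q.eval₂ φ θ = 0 := by
      have := congrArg (eval₂ φ θ) e
      rw [eval₂_mul, eval₂_mul, hz, mul_zero] at this
      exact (mul_eq_zero.mp this.symm).resolve_right hrθ
    have hdh : C d * h ≠ 0 := mul_ne_zero (C_ne_zero.mpr hd) hh
    have hq0 : q ≠ 0 := by
      rintro rfl
      exact hdh (by rw [e, zero_mul])
    have hle : h.degree ≤ q.degree := not_lt.mp fun hlt => hq0 (hmin' q hqθ hlt)
    have hsum := congrArg natDegree e
    rw [natDegree_C_mul hd, natDegree_mul hq0 hr] at hsum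
    have := natDegree_le_natDegree hle
    obtain ⟨c, hc⟩ := natDegree_eq_zero.mp (show r.natDegree = 0 by omega)
    refine ⟨c, ?_, u, v, by rw [hc, hruv]⟩
    rintro rfl
    exact hr (by rw [← hc, C_0])

/-! ### Differential polynomials by order, and reduction modulo a separant -/

section Specialization

variable {L U : Type*} [CommRing L] [Field U] [Differential U]

/-- Evaluation of a differential polynomial at `b`, its coefficients being mapped along `τ`. -/
noncomputable def diffEvalHom (τ : L →+* U) (b : U) : MvPolynomial ℕ L →+* U :=
  MvPolynomial.eval₂Hom τ (fun i => (Differential.deriv : U → U)^[i] b)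

@[simp] theorem diffEvalHom_C (τ : L →+* U) (b : U) (x : L) :
    diffEvalHom τ b (MvPolynomial.C x) = τ x := by
  simp [diffEvalHom]

@[simp] theorem diffEvalHom_X (τ : L →+* U) (b : U) (i : ℕ) :
    diffEvalHom τ b (MvPolynomial.X i) = (Differential.deriv : U → U)^[i] b := by
  simp [diffEvalHom]

variable (L) in
/-- The differential polynomials of order less than `m`. -/
noncomputable abbrev lowerOrder (m : ℕ) : Subalgebra L (MvPolynomial ℕ L) :=
  MvPolynomial.supported L (Set.Iio m)

theorem X_mem_lowerOrder {i m : ℕ} (h : i < m) : (MvPolynomial.X i) ∈ lowerOrder L m :=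
  Algebra.subset_adjoin ⟨i, h, rfl⟩

theorem C_mem_lowerOrder (m : ℕ) (x : L) : (MvPolynomial.C x) ∈ lowerOrder L m :=
  (lowerOrder L m).algebraMap_mem x

theorem lowerOrder_mono {m n : ℕ} (h : m ≤ n) : lowerOrder L m ≤ lowerOrder L n :=
  MvPolynomial.supported_mono (Set.Iio_subset_Iio h)

/-- A polynomial over the differential polynomials of order less than `m`, regarded as a
differential polynomial by substituting `T^(m)` for the variable. -/
noncomputable def ofLowerOrder (m : ℕ) : Polynomial (lowerOrder L m) →+* MvPolynomial ℕ L :=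
  Polynomial.eval₂RingHom (lowerOrder L m).val.toRingHom (MvPolynomial.X m)

theorem ofLowerOrder_C (m : ℕ) (x : lowerOrder L m) :
    ofLowerOrder m (Polynomial.C x) = x := by
  simp [ofLowerOrder]

theorem ofLowerOrder_X (m : ℕ) :
    ofLowerOrder (L := L) m Polynomial.X = MvPolynomial.X m := by
  simp [ofLowerOrder]

theorem exists_ofLowerOrder_eq {m : ℕ} {P : MvPolynomial ℕ L} (hP : P ∈ lowerOrder L (m + 1)) :
    ∃ p, ofLowerOrder m p = P := by
  induction hP using Algebra.adjoin_induction with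
  | mem x hx =>
    obtain ⟨i, hi, rfl⟩ := hx
    rcases Nat.lt_succ_iff_lt_or_eq.mp hi with h | rfl
    · exact ⟨Polynomial.C ⟨_, X_mem_lowerOrder h⟩, ofLowerOrder_C _ _⟩
    · exact ⟨Polynomial.X, ofLowerOrder_X _⟩
  | algebraMap r => exact ⟨Polynomial.C ⟨_, C_mem_lowerOrder m r⟩, ofLowerOrder_C _ _⟩
  | add x y _ _ h1 h2 =>
    obtain ⟨p, rfl⟩ := h1
    obtain ⟨q, rfl⟩ := h2
    exact ⟨p + q, map_add _ _ _⟩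
  | mul x y _ _ h1 h2 =>
    obtain ⟨p, rfl⟩ := h1
    obtain ⟨q, rfl⟩ := h2
    exact ⟨p * q, map_mul _ _ _⟩

/-- Evaluation at `b` of differential polynomials of order less than `m`. -/
noncomputable abbrev lowerEval (τ : L →+* U) (b : U) (m : ℕ) : lowerOrder L m →+* U :=
  (diffEvalHom τ b).comp (lowerOrder L m).val.toRingHom

theorem diffEvalHom_ofLowerOrder (τ : L →+* U) (b : U) (m : ℕ) (p : Polynomial (lowerOrder L m)) :
    diffEvalHom τ b (ofLowerOrder m p) =
      p.eval₂ (lowerEval τ b m) ((Differential.deriv : U → U)^[m] b) := by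
  rw [ofLowerOrder, Polynomial.coe_eval₂RingHom, Polynomial.hom_eval₂, diffEvalHom_X]

theorem ofLowerOrder_mem {m : ℕ} (p : Polynomial (lowerOrder L m)) :
    ofLowerOrder m p ∈ lowerOrder L (m + 1) := by
  induction p using Polynomial.induction_on' with
  | add p q hp hq =>
    rw [map_add]
    exact add_mem hp hq
  | monomial n x =>
    rw [← Polynomial.C_mul_X_pow_eq_monomial, map_mul, map_pow, ofLowerOrder_C, ofLowerOrder_X]
    exact mul_mem (lowerOrder_mono m.le_succ x.2) (pow_mem (X_mem_lowerOrder m.lt_succ_self) n)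

/-- `τ` commutes with `d` on `L` and the derivation of `U`. -/
def DerivCompat (d : L → L) (τ : L →+* U) : Prop :=
  ∀ x, Differential.deriv (τ x) = τ (d x)

/-- `P'` is chosen before `τ` and `b`, so that one formal identity can be used both at the original
point and at its specialization. -/
theorem exists_deriv_of_mem_lowerOrder (U : Type*) [Field U] [Differential U] (d : L → L) {m : ℕ}
    {P : MvPolynomial ℕ L} (hP : P ∈ lowerOrder L m) :
    ∃ P' ∈ lowerOrder L (m + 1), ∀ (τ : L →+* U) (b : U), DerivCompat d τ →
      Differential.deriv (diffEvalHom τ b P) = diffEvalHom τ b P' := by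
  induction hP using Algebra.adjoin_induction with
  | mem x hx =>
    obtain ⟨i, hi, rfl⟩ := hx
    refine ⟨_, X_mem_lowerOrder (Nat.succ_lt_succ hi), fun τ b _ => ?_⟩
    rw [diffEvalHom_X, diffEvalHom_X, Function.iterate_succ_apply']
  | algebraMap r =>
    refine ⟨_, C_mem_lowerOrder _ (d r), fun τ b hτ => ?_⟩
    rw [MvPolynomial.algebraMap_eq, diffEvalHom_C, diffEvalHom_C, hτ]
  | add x y _ _ h1 h2 =>
    obtain ⟨p, hp, ep⟩ := h1
    obtain ⟨q, hq, eq⟩ := h2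
    refine ⟨p + q, add_mem hp hq, fun τ b hτ => ?_⟩
    rw [map_add, map_add, map_add, ep τ b hτ, eq τ b hτ]
  | mul x y hx hy h1 h2 =>
    obtain ⟨p, hp, ep⟩ := h1
    obtain ⟨q, hq, eq⟩ := h2
    have hm := lowerOrder_mono (L := L) m.le_succ
    refine ⟨x * q + y * p, add_mem (mul_mem (hm hx) hq) (mul_mem (hm hy) hp), fun τ b hτ => ?_⟩
    rw [map_mul, Derivation.leibniz, ep τ b hτ, eq τ b hτ]
    simp

/-- By the chain rule, the derivative is linear in the new top derivative, with the separant as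
coefficient. -/
theorem exists_deriv_ofLowerOrder (U : Type*) [Field U] [Differential U] (d : L → L) {m : ℕ}
    (h : Polynomial (lowerOrder L m)) :
    ∃ w ∈ lowerOrder L (m + 1), ∀ (τ : L →+* U) (b : U), DerivCompat d τ →
      Differential.deriv (diffEvalHom τ b (ofLowerOrder m h)) =
        diffEvalHom τ b (ofLowerOrder m h.derivative) * (Differential.deriv : U → U)^[m + 1] b
          + diffEvalHom τ b w := by
  induction h using Polynomial.induction_on' with
  | add p q hp hq =>
    obtain ⟨v, hv, ev⟩ := hp
    obtain ⟨w, hw, ew⟩ := hq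
    refine ⟨v + w, add_mem hv hw, fun τ b hτ => ?_⟩
    simp only [map_add, ev τ b hτ, ew τ b hτ]
    ring
  | monomial n x =>
    obtain ⟨x', hx', ex⟩ := exists_deriv_of_mem_lowerOrder U d x.2
    refine ⟨x' * MvPolynomial.X m ^ n,
      mul_mem hx' (pow_mem (X_mem_lowerOrder m.lt_succ_self) n), fun τ b hτ => ?_⟩
    rw [Polynomial.derivative_monomial, ← Polynomial.C_mul_X_pow_eq_monomial,
      ← Polynomial.C_mul_X_pow_eq_monomial]
    simp only [map_mul, map_pow, ofLowerOrder_C, ofLowerOrder_X, diffEvalHom_X, map_natCast]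
    rw [Derivation.leibniz, ex τ b hτ, Derivation.leibniz_pow, Function.iterate_succ_apply']
    simp only [smul_eq_mul, nsmul_eq_mul]
    ring

/-- Along the zeros of `h`, every differential polynomial agrees with one of order at most `m`, up
to a power of the separant of `h`. -/
theorem exists_reduction (U : Type*) [Field U] [Differential U] (d : L → L) {m : ℕ}
    (h : Polynomial (lowerOrder L m)) (Q : MvPolynomial ℕ L) :
    ∃ (k : ℕ) (P : MvPolynomial ℕ L), P ∈ lowerOrder L (m + 1) ∧
      ∀ (τ : L →+* U) (b : U), DerivCompat d τ → diffEvalHom τ b (ofLowerOrder m h) = 0 →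
        diffEvalHom τ b (ofLowerOrder m h.derivative) ^ k * diffEvalHom τ b Q =
          diffEvalHom τ b P := by
  set s := ofLowerOrder m h.derivative
  set Good : MvPolynomial ℕ L → Prop := fun Q =>
    ∃ (k : ℕ) (P : MvPolynomial ℕ L), P ∈ lowerOrder L (m + 1) ∧
      ∀ (τ : L →+* U) (b : U), DerivCompat d τ → diffEvalHom τ b (ofLowerOrder m h) = 0 →
        diffEvalHom τ b s ^ k * diffEvalHom τ b Q = diffEvalHom τ b P
  have hsm : s ∈ lowerOrder L (m + 1) := ofLowerOrder_mem _
  have low : ∀ P ∈ lowerOrder L (m + 1), Good P := fun P hP =>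
    ⟨0, P, hP, fun τ b _ _ => by rw [pow_zero, one_mul]⟩
  have add : ∀ P Q, Good P → Good Q → Good (P + Q) := by
    rintro P Q ⟨k, P', hP', eP⟩ ⟨l, Q', hQ', eQ⟩
    refine ⟨k + l, s ^ l * P' + s ^ k * Q', add_mem (mul_mem (pow_mem hsm _) hP')
      (mul_mem (pow_mem hsm _) hQ'), fun τ b hτ hb => ?_⟩
    simp only [map_add, map_mul, map_pow, ← eP τ b hτ hb, ← eQ τ b hτ hb]
    ring
  have mul : ∀ P Q, Good P → Good Q → Good (P * Q) := by
    rintro P Q ⟨k, P', hP', eP⟩ ⟨l, Q', hQ', eQ⟩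
    refine ⟨k + l, P' * Q', mul_mem hP' hQ', fun τ b hτ hb => ?_⟩
    simp only [map_mul, ← eP τ b hτ hb, ← eQ τ b hτ hb]
    ring
  -- Differentiating `h(b) = 0` and solving for the top derivative costs one factor `s`.
  have hXsucc : Good (MvPolynomial.X (m + 1)) := by
    obtain ⟨w, hw, ew⟩ := exists_deriv_ofLowerOrder U d h
    refine ⟨1, -w, neg_mem hw, fun τ b hτ hb => ?_⟩
    have := ew τ b hτ
    rw [hb, map_zero] at this
    rw [diffEvalHom_X, map_neg, pow_one]
    linear_combination -this
  have low' : ∀ P ∈ lowerOrder L (m + 2), Good P := by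
    intro P hP
    induction hP using Algebra.adjoin_induction with
    | mem x hx =>
      obtain ⟨i, hi, rfl⟩ := hx
      rcases Nat.lt_succ_iff_lt_or_eq.mp hi with h | rfl
      · exact low _ (X_mem_lowerOrder h)
      · exact hXsucc
    | algebraMap r => exact low _ (C_mem_lowerOrder _ r)
    | add x y _ _ h1 h2 => exact add _ _ h1 h2
    | mul x y _ _ h1 h2 => exact mul _ _ h1 h2
  -- Differentiating `s^k Q = P` gives `s^k Q' = P' - k s^(k-1) s' Q`, whose right side is good. For
  -- `k = 0` the truncated exponent is harmless, because of the factor `k`.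
  have der : ∀ Q Q', Good Q → (∀ (τ : L →+* U) (b : U), DerivCompat d τ →
      Differential.deriv (diffEvalHom τ b Q) = diffEvalHom τ b Q') → Good Q' := by
    rintro Q Q' hQ hQ'
    obtain ⟨k, P, hP, eP⟩ := id hQ
    obtain ⟨P', hP', eP'⟩ := exists_deriv_of_mem_lowerOrder U d hP
    obtain ⟨s', hs', es'⟩ := exists_deriv_of_mem_lowerOrder U d hsm
    obtain ⟨j, R, hR, eR⟩ := add P' (MvPolynomial.C (-(k : L)) * s ^ (k - 1) * s' * Q)
      (low' _ hP') (mul _ _ (mul _ _ (mul _ _ (low _ (C_mem_lowerOrder _ _))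
        (low _ (pow_mem hsm _))) (low' _ hs')) hQ)
    refine ⟨j + k, R, hR, fun τ b hτ hb => ?_⟩
    rw [← eR τ b hτ hb]
    have := congrArg Differential.deriv (eP τ b hτ hb)
    rw [Derivation.leibniz, Derivation.leibniz_pow, hQ' τ b hτ, es' τ b hτ, eP' τ b hτ] at this
    simp only [smul_eq_mul, nsmul_eq_mul] at this
    simp only [map_add, map_mul, map_pow, map_neg, map_natCast, ← this]
    ring
  have hX : ∀ i, Good (MvPolynomial.X i) := by
    intro i
    induction i with
    | zero => exact low _ (X_mem_lowerOrder m.succ_pos)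
    | succ i ih =>
      refine der _ _ ih fun τ b _ => ?_
      rw [diffEvalHom_X, diffEvalHom_X, Function.iterate_succ_apply']
  change Good Q
  induction Q using MvPolynomial.induction_on with
  | C x => exact low _ (C_mem_lowerOrder _ x)
  | add P Q hP hQ => exact add _ _ hP hQ
  | mul_X P i hP => exact mul _ _ hP (hX i)

/-! ### Specialization of a zero along another embedding -/

/-- A differentially algebraic element has a fraction-free minimal polynomial of minimal order. -/
theorem exists_minimal_order {ι : L →+* U} (hι : Function.Injective ι)
    {a : U} {N : ℕ} {H : MvPolynomial ℕ L} (hH : H ∈ lowerOrder L (N + 1)) (hH0 : H ≠ 0)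
    (ha : diffEvalHom ι a H = 0) :
    ∃ m ≤ N, Function.Injective (lowerEval ι a m) ∧ ∃ p : Polynomial (lowerOrder L m), p ≠ 0 ∧
      p.eval₂ (lowerEval ι a m) ((Differential.deriv : U → U)^[m] a) = 0 := by
  classical
  have hex : ∃ m, ∃ H ∈ lowerOrder L (m + 1), H ≠ 0 ∧ diffEvalHom ι a H = 0 :=
    ⟨N, H, hH, hH0, ha⟩
  refine ⟨Nat.find hex, Nat.find_min' hex ⟨H, hH, hH0, ha⟩, ?_, ?_⟩
  · rw [injective_iff_map_eq_zero]
    rintro ⟨P, hP⟩ h0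
    change diffEvalHom ι a P = 0 at h0
    suffices P = 0 from Subtype.ext this
    rcases hm : Nat.find hex with _ | k
    · rw [hm] at hP
      have hemp : (Set.Iio 0 : Set ℕ) = ∅ := by simp
      rw [lowerOrder, hemp, MvPolynomial.supported_empty, Algebra.mem_bot] at hP
      obtain ⟨x, rfl⟩ := hP
      rw [MvPolynomial.algebraMap_eq, diffEvalHom_C, map_eq_zero_iff ι hι] at h0
      rw [h0, map_zero]
    · by_contra hne
      rw [hm] at hP
      exact Nat.find_min hex (m := k) (by omega) ⟨P, hP, hne, h0⟩
  · obtain ⟨H, hH, hH0, ha⟩ := Nat.find_spec hex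
    obtain ⟨p, rfl⟩ := exists_ofLowerOrder_eq hH
    refine ⟨p, ?_, by rwa [diffEvalHom_ofLowerOrder] at ha⟩
    rintro rfl
    exact hH0 (map_zero _)

theorem diffOrd_lt_of_mem_lowerOrder {R : Type*} [CommRing R] {m : ℕ} {P : MvPolynomial ℕ R}
    (hP : P ∈ lowerOrder R m) : diffOrd P < m := by
  rw [MvPolynomial.mem_supported] at hP
  rw [diffOrd]
  rcases hi : P.vars.max with _ | i
  · exact WithBot.bot_lt_coe m
  · exact WithBot.coe_lt_coe.mpr (hP (Finset.mem_of_max hi))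

/-- A nonzero separant thus shows that `T^(m)` really occurs, so that the order is exactly `m`. -/
theorem pderiv_ofLowerOrder {m : ℕ} (h : Polynomial (lowerOrder L m)) :
    MvPolynomial.pderiv m (ofLowerOrder m h) = ofLowerOrder m h.derivative := by
  induction h using Polynomial.induction_on' with
  | add p q hp hq => simp only [map_add, hp, hq]
  | monomial n x =>
    have hx : MvPolynomial.pderiv m (x : MvPolynomial ℕ L) = 0 :=
      MvPolynomial.pderiv_eq_zero_of_notMem_vars fun hm =>
        lt_irrefl m (MvPolynomial.mem_supported.mp x.2 hm)
    rw [Polynomial.derivative_monomial, ← Polynomial.C_mul_X_pow_eq_monomial,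
      ← Polynomial.C_mul_X_pow_eq_monomial]
    simp only [map_mul, map_pow, ofLowerOrder_C, ofLowerOrder_X, map_natCast]
    rw [Derivation.leibniz, hx, Derivation.leibniz_pow, MvPolynomial.pderiv_X_self]
    simp only [smul_eq_mul, nsmul_eq_mul]
    ring

theorem diffEval_map (σ : L →+* U) (b : U) (P : MvPolynomial ℕ L) :
    diffEval U b (MvPolynomial.map σ P) = diffEvalHom σ b P := by
  rw [diffEval, MvPolynomial.aeval_def, MvPolynomial.eval₂_map]
  rfl

/-- A differentially algebraic element `a` over `L ⊆ U` can be specialized along another embedding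
`σ` of `L` into a differentially closed field, respecting finitely many equations and
inequations. -/
theorem exists_specialization [IsDomain L] [CharZero U] (hU : IsDifferentiallyClosed U)
    {d : L → L} {ι σ : L →+* U} (hι : Function.Injective ι) (hσ : Function.Injective σ)
    (hdι : DerivCompat d ι) (hdσ : DerivCompat d σ)
    {a : U} {N : ℕ} {H : MvPolynomial ℕ L} (hH : H ∈ lowerOrder L (N + 1)) (hH0 : H ≠ 0)
    (ha : diffEvalHom ι a H = 0) (S : Finset (MvPolynomial ℕ L)) :
    ∃ b : U, ∀ Q ∈ S, diffEvalHom σ b Q = 0 ↔ diffEvalHom ι a Q = 0 := by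
  obtain ⟨m, -, hinj, hp⟩ := exists_minimal_order hι hH hH0 ha
  obtain ⟨h, hh, hsep, hdvd, hbez⟩ := exists_pseudo_minpoly hinj hp
  -- Each condition is preserved at every zero of `h` where a suitable nonzero `g` of order below
  -- `m` does not vanish. After reduction to order at most `m`, an equation follows from
  -- divisibility by `h`, an inequation from Bézout's identity with `h`. For an equation, the factor
  -- `e` also keeps the separant nonzero.
  have key : ∀ Q : MvPolynomial ℕ L, ∃ g : lowerOrder L m, g ≠ 0 ∧ ∀ b : U,
      diffEvalHom σ b (ofLowerOrder m h) = 0 → diffEvalHom σ b g ≠ 0 →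
        (diffEvalHom σ b Q = 0 ↔ diffEvalHom ι a Q = 0) := by
    intro Q
    obtain ⟨e, he, u, v, huv⟩ := hbez _ hsep
    obtain ⟨k, P, hP, eP⟩ := exists_reduction U d h Q
    obtain ⟨p, rfl⟩ := exists_ofLowerOrder_eq hP
    have hsepb : ∀ b : U, diffEvalHom σ b (ofLowerOrder m h) = 0 → diffEvalHom σ b e ≠ 0 →
        diffEvalHom σ b (ofLowerOrder m h.derivative) ≠ 0 := by
      intro b hb hne h0
      have := congrArg (fun q => diffEvalHom σ b (ofLowerOrder m q)) huv
      simp only [map_add, map_mul, hb, h0, mul_zero, add_zero, ofLowerOrder_C] at this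
      exact hne this
    have hPa := eP ι a hdι (by rw [diffEvalHom_ofLowerOrder, hh])
    rw [← diffEvalHom_ofLowerOrder] at hsep
    by_cases hQ : diffEvalHom ι a Q = 0
    · rw [hQ, mul_zero, diffEvalHom_ofLowerOrder] at hPa
      obtain ⟨g, hg, q, eq⟩ := hdvd p hPa.symm
      refine ⟨e * g, mul_ne_zero he hg, fun b hb hne => iff_of_true ?_ hQ⟩
      rw [MulMemClass.coe_mul, map_mul, mul_ne_zero_iff] at hne
      have h1 := congrArg (fun q => diffEvalHom σ b (ofLowerOrder m q)) eq
      simp only [map_mul, hb, mul_zero, ofLowerOrder_C] at h1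
      have h2 := eP σ b hdσ hb
      rw [(mul_eq_zero.mp h1).resolve_left hne.2] at h2
      exact (mul_eq_zero.mp h2).resolve_left (pow_ne_zero _ (hsepb b hb hne.1))
    · have hpa := mul_ne_zero (pow_ne_zero k hsep) hQ
      rw [hPa, diffEvalHom_ofLowerOrder] at hpa
      obtain ⟨g, hg, u', v', huv'⟩ := hbez p hpa
      refine ⟨g, hg, fun b hb hne => iff_of_false (fun h0 => hne ?_) hQ⟩
      have h1 := congrArg (fun q => diffEvalHom σ b (ofLowerOrder m q)) huv'
      have h2 := eP σ b hdσ hb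
      rw [h0, mul_zero] at h2
      simpa only [map_add, map_mul, hb, ← h2, mul_zero, add_zero, ofLowerOrder_C] using h1
  choose g hg0 hg using key
  have hsep' : ofLowerOrder m h.derivative ≠ 0 := by
    intro h0
    rw [← diffEvalHom_ofLowerOrder, h0, map_zero] at hsep
    exact hsep rfl
  have hvar : m ∈ (ofLowerOrder m h).vars := by
    by_contra hm
    exact hsep' ((pderiv_ofLowerOrder h).symm.trans
      (MvPolynomial.pderiv_eq_zero_of_notMem_vars hm))
  have hG : (∏ Q ∈ S, g Q) ≠ 0 := Finset.prod_ne_zero_iff.mpr fun Q _ => hg0 Q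
  have hinjσ := MvPolynomial.map_injective (σ := ℕ) σ hσ
  -- All conditions are now one equation of order `m` and one inequation of lower order, the product
  -- of the `g Q`.
  obtain ⟨b, hb, hGb⟩ := hU (MvPolynomial.map σ (ofLowerOrder m h))
    (MvPolynomial.map σ ((∏ Q ∈ S, g Q : lowerOrder L m) : MvPolynomial ℕ L))
    (fun h0 => by
      rw [map_eq_zero_iff _ hinjσ] at h0
      simp [h0] at hvar)
    (fun h0 => by
      rw [map_eq_zero_iff _ hinjσ] at h0
      exact hG (Subtype.ext h0))
    (by
      rw [diffOrd, diffOrd, MvPolynomial.vars_map_of_injective _ hσ,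
        MvPolynomial.vars_map_of_injective _ hσ]
      exact lt_of_lt_of_le (diffOrd_lt_of_mem_lowerOrder (∏ Q ∈ S, g Q).2) (Finset.le_max hvar))
  rw [diffEval_map] at hb hGb
  refine ⟨b, fun Q hQ => hg Q b hb fun h0 => hGb ?_⟩
  obtain ⟨r, hr⟩ := Finset.dvd_prod_of_mem g hQ
  rw [hr, MulMemClass.coe_mul, map_mul, h0, zero_mul]

end Specialization

/-! ### Independence and algebraic closures -/

theorem transcendental_of_notMem_range {K U : Type*} [Field K] [IsAlgClosed K] [Field U]
    [Algebra K U] {c : U}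
    (hc : c ∉ (algebraMap K U).range) : Transcendental K c := fun halg =>
  hc (minpoly.mem_range_of_degree_eq_one K c
    (IsAlgClosed.degree_eq_one_of_irreducible K (minpoly.irreducible halg.isIntegral)))

/-- The algebraic closures of two complementary parts of an algebraically independent family meet
in the algebraic closure of the base field. -/
theorem isAlgebraic_of_algebraicIndependent {K U κ : Type*} [Field K]
    [Field U] [Algebra K U] {m : ℕ} {x : Fin m × κ → U}
    (hx : AlgebraicIndependent K x) {i j : Fin m} (hij : i ≠ j) {c : U}
    (hi : IsAlgebraic (Algebra.adjoin K (Set.range fun k => x (i, k))) c)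
    (hj : IsAlgebraic (Algebra.adjoin K (Set.range fun k => x (j, k))) c) : IsAlgebraic K c := by
  -- In a matroid, for two subsets of an independent set, the intersection of the closures is the
  -- closure of the intersection, here empty.
  have hind : (AlgebraicIndependent.matroid K U).Indep
      ((Set.range fun k => x (i, k)) ∪ Set.range fun k => x (j, k)) := by
    refine Matroid.Indep.subset (AlgebraicIndependent.matroid_indep_iff.mpr hx.coe_range) ?_
    rintro _ (⟨k, rfl⟩ | ⟨k, rfl⟩)
    exacts [⟨_, rfl⟩, ⟨_, rfl⟩]
  have hempty : ((Set.range fun k => x (i, k)) ∩ Set.range fun k => x (j, k)) = ∅ := by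
    rw [Set.eq_empty_iff_forall_notMem]
    rintro _ ⟨⟨k, rfl⟩, ⟨l, e⟩⟩
    exact hij (congrArg Prod.fst (hx.injective e)).symm
  have hc : c ∈ (AlgebraicIndependent.matroid K U).closure ∅ := by
    rw [← hempty, hind.closure_inter_eq_inter_closure, AlgebraicIndependent.matroid_closure_eq,
      AlgebraicIndependent.matroid_closure_eq]
    exact ⟨hi, hj⟩
  rw [AlgebraicIndependent.matroid_closure_eq] at hc
  replace hc : IsAlgebraic (Algebra.adjoin K (∅ : Set U)) c := hc
  rwa [Algebra.adjoin_empty, Subalgebra.isAlgebraic_bot_iff (algebraMap K U).injective] at hc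

section Adjoin

variable {K U : Type*} [Field K] [Field U] [Differential U] [Algebra K U]

theorem diffEvalHom_algebraMap (a : U) (P : MvPolynomial ℕ K) :
    diffEvalHom (algebraMap K U) a P = diffEval K a P := rfl

/-- If `a` satisfies a differential equation of order at most `n` over `K`, then `K⟨a⟩` is
algebraic over `K(a, δ a, …, δ^(n-1) a)`. -/
theorem isAlgebraic_of_mem_diffAdjoin [Differential K] [DifferentialAlgebra K U] [CharZero U]
    {a : U} {n : ℕ} {H : MvPolynomial ℕ K} (hH : H ∈ lowerOrder K (n + 1)) (hH0 : H ≠ 0)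
    (ha : diffEval K a H = 0) {x : U} (hx : x ∈ diffAdjoin K a) :
    IsAlgebraic (Algebra.adjoin K
      (Set.range fun i : Fin n => (Differential.deriv : U → U)^[(i : ℕ)] a)) x := by
  set S := Set.range fun i : Fin n => (Differential.deriv : U → U)^[(i : ℕ)] a
  have hι := (algebraMap K U).injective
  have hd : DerivCompat (fun k : K => Differential.deriv k) (algebraMap K U) :=
    fun k => deriv_algebraMap k
  obtain ⟨m, hmn, hinj, hp⟩ := exists_minimal_order hι hH hH0 ha
  obtain ⟨h, hh, hsep, -, -⟩ := exists_pseudo_minpoly hinj hp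
  let M : IntermediateField K U :=
    { (Subalgebra.algebraicClosure (Algebra.adjoin K S) U).restrictScalars K with
      inv_mem' := fun x hx => IsAlgebraic.inv hx }
  have hSM : ∀ x ∈ Algebra.adjoin K S, x ∈ M := fun x hx =>
    isAlgebraic_algebraMap (⟨x, hx⟩ : Algebra.adjoin K S)
  have hlow : ∀ P ∈ lowerOrder K m, diffEvalHom (algebraMap K U) a P ∈ Algebra.adjoin K S := by
    intro P hP
    induction hP using Algebra.adjoin_induction with
    | mem x hx =>
      obtain ⟨i, hi, rfl⟩ := hx
      rw [diffEvalHom_X]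
      exact Algebra.subset_adjoin ⟨⟨i, lt_of_lt_of_le hi hmn⟩, rfl⟩
    | algebraMap r =>
      rw [MvPolynomial.algebraMap_eq, diffEvalHom_C]
      exact Subalgebra.algebraMap_mem _ r
    | add x y _ _ h1 h2 =>
      rw [map_add]
      exact add_mem h1 h2
    | mul x y _ _ h1 h2 =>
      rw [map_mul]
      exact mul_mem h1 h2
  have hθ : (Differential.deriv : U → U)^[m] a ∈ M := by
    obtain ⟨p, hp0, hp⟩ := hp
    let ψ : lowerOrder K m →+* Algebra.adjoin K S :=
      (lowerEval (algebraMap K U) a m).codRestrict _ fun P => hlow P P.2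
    have hψ : Function.Injective ψ := fun x y e => hinj (congrArg Subtype.val e)
    refine ⟨p.map ψ, (Polynomial.map_ne_zero_iff hψ).mpr hp0, ?_⟩
    rw [Polynomial.aeval_def, Polynomial.eval₂_map]
    exact hp
  have hlow' : ∀ P ∈ lowerOrder K (m + 1), diffEvalHom (algebraMap K U) a P ∈ M := by
    intro P hP
    induction hP using Algebra.adjoin_induction with
    | mem x hx =>
      obtain ⟨i, hi, rfl⟩ := hx
      rcases Nat.lt_succ_iff_lt_or_eq.mp hi with h | rfl
      · exact hSM _ (hlow _ (X_mem_lowerOrder h))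
      · rwa [diffEvalHom_X]
    | algebraMap r => exact hSM _ (hlow _ (C_mem_lowerOrder _ r))
    | add x y _ _ h1 h2 =>
      rw [map_add]
      exact add_mem h1 h2
    | mul x y _ _ h1 h2 =>
      rw [map_mul]
      exact mul_mem h1 h2
  suffices diffAdjoin K a ≤ M from this hx
  rw [diffAdjoin, IntermediateField.adjoin_le_iff]
  rintro _ ⟨i, rfl⟩
  -- Since the separant does not vanish at `a`, every derivative of `a` is a quotient of expressions
  -- of order at most `m`.
  obtain ⟨k, P, hP, eP⟩ := exists_reduction U (fun k : K => Differential.deriv k) h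
    (MvPolynomial.X i)
  have e := eP (algebraMap K U) a hd (by rw [diffEvalHom_ofLowerOrder, hh])
  rw [← diffEvalHom_ofLowerOrder] at hsep
  rw [diffEvalHom_X, mul_comm, ← eq_div_iff (pow_ne_zero k hsep)] at e
  change (Differential.deriv : U → U)^[i] a ∈ M
  rw [e]
  exact div_mem (hlow' P hP) (pow_mem (hlow' _ (ofLowerOrder_mem _)) k)

end Adjoin

/-! ### Moving a new constant -/

section Constants

variable {K U : Type*} [Field K] [Field U] [Differential U] [Algebra K U]

-- With coefficientwise derivation on `K[X]`, the variable is a constant, so it may be sent to any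
-- constant of `U`.
open Polynomial in
theorem derivCompat_eval₂RingHom [Differential K] [DifferentialAlgebra K U] {c : U}
    (hc : Differential.deriv c = 0) :
    DerivCompat (fun p : K[X] => Differential.mapCoeffs p)
      (eval₂RingHom (algebraMap K U) c) := by
  intro p
  have := Differential.deriv_aeval_eq c p
  rwa [hc, mul_zero, add_zero] at this

open Polynomial in
theorem diffEvalHom_map_C (c b : U) (P : MvPolynomial ℕ K) :
    diffEvalHom (eval₂RingHom (algebraMap K U) c) b (MvPolynomial.map C P) = diffEval K b P := by
  have hC : (eval₂RingHom (algebraMap K U) c).comp C = algebraMap K U := by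
    ext x
    simp
  rw [diffEvalHom, MvPolynomial.coe_eval₂Hom, MvPolynomial.eval₂_map, hC]
  rfl

theorem num_ne_zero (E : DiffAlgEquation K) : E.num ≠ 0 := by
  intro h
  have := E.ord_den_lt
  simp [h, diffOrd] at this

theorem num_mem_lowerOrder (E : DiffAlgEquation K) : E.num ∈ lowerOrder K (E.order + 1) := by
  rw [MvPolynomial.mem_supported]
  intro i hi
  have h : WithBot.some i ≤ WithBot.some E.order :=
    (Finset.le_max hi).trans_eq (WithBot.coe_unbot _ _).symm
  exact Nat.lt_succ_of_le (WithBot.coe_le_coe.mp h)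

theorem div_mem_diffAdjoin (f g : MvPolynomial ℕ K) (b : U) :
    diffEval K b f / diffEval K b g ∈ diffAdjoin K b :=
  (IntermediateField.mem_adjoin_range_iff K _ _).mpr ⟨f, g, rfl⟩

open Polynomial in
/-- A new constant `c` of `K⟨a⟩` can be moved: the same differential rational function of another
solution equals `c + 1`. -/
theorem exists_solution_of_transcendental_constant [Differential K] [DifferentialAlgebra K U]
    [CharZero U] (hU : IsDifferentiallyClosed U) (E : DiffAlgEquation K) {a : U}
    (ha : E.IsSolution a) {f g : MvPolynomial ℕ K} (hg : diffEval K a g ≠ 0)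
    (hc0 : Differential.deriv (diffEval K a f / diffEval K a g) = 0)
    (hc : Transcendental K (diffEval K a f / diffEval K a g)) :
    ∃ b : U, E.IsSolution b ∧
      diffEval K b f / diffEval K b g = diffEval K a f / diffEval K a g + 1 := by
  set c := diffEval K a f / diffEval K a g with hcdef
  have hc1 : Transcendental K (c + 1) := fun h => hc (by
    simpa using h.sub (isAlgebraic_one (R := K) (A := U)))
  have hinj : Function.Injective (MvPolynomial.map (σ := ℕ) (C : K →+* K[X])) :=
    MvPolynomial.map_injective _ C_injective
  classical
  obtain ⟨b, hb⟩ := exists_specialization hU (L := K[X]) (a := a) (N := E.order)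
    (H := MvPolynomial.map C E.num)
    (ι := eval₂RingHom (algebraMap K U) c) (σ := eval₂RingHom (algebraMap K U) (c + 1))
    (transcendental_iff_injective.mp hc) (transcendental_iff_injective.mp hc1)
    (derivCompat_eval₂RingHom hc0) (derivCompat_eval₂RingHom (by simp [hc0]))
    (by
      rw [MvPolynomial.mem_supported, MvPolynomial.vars_map_of_injective _ C_injective,
        ← MvPolynomial.mem_supported]
      exact num_mem_lowerOrder E)
    (by
      rw [Ne, map_eq_zero_iff _ hinj]
      exact num_ne_zero E)
    (by rw [diffEvalHom_map_C, ha.1])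
    -- The last condition holds at `a` because `X` stands for `c`; at `b`, where `X` stands for `c +
    -- 1`, it prescribes the value of `f/g`.
    {MvPolynomial.map C E.num, MvPolynomial.map C E.den, MvPolynomial.map C g,
      MvPolynomial.map C f - MvPolynomial.C X * MvPolynomial.map C g}
  simp only [Finset.mem_insert, Finset.mem_singleton, forall_eq_or_imp, forall_eq, map_sub,
    map_mul, diffEvalHom_map_C, diffEvalHom_C, coe_eval₂RingHom, eval₂_X] at hb
  obtain ⟨h1, h2, h3, h4⟩ := hb
  refine ⟨b, ⟨h1.mpr ha.1, fun h => ha.2 (h2.mp h)⟩, ?_⟩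
  rw [div_eq_iff fun h => hg (h3.mp h)]
  refine sub_eq_zero.mp (h4.mpr ?_)
  rw [hcdef, div_mul_cancel₀ _ hg, sub_self]

theorem mem_range_of_deriv_eq_zero [Differential K] [DifferentialAlgebra K U] [CharZero U]
    [IsAlgClosed K] (hU : IsDifferentiallyClosed U) (E : DiffAlgEquation K)
    (hD : E.PropertyD U 2) {a : U} (ha : E.IsSolution a) (halg : ¬ IsAlgebraic K a) {c : U}
    (hc : c ∈ diffAdjoin K a) (hc0 : Differential.deriv c = 0) : c ∈ (algebraMap K U).range := by
  by_contra hcK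
  have htr := transcendental_of_notMem_range hcK
  obtain ⟨f, g, hfg⟩ := (IntermediateField.mem_adjoin_range_iff K _ _).mp hc
  change c = diffEval K a f / diffEval K a g at hfg
  -- A zero denominator would give `c = 0` by the convention for division, and `0` lies in `K`.
  have hg : diffEval K a g ≠ 0 := by
    intro h
    rw [h, div_zero] at hfg
    exact hcK (hfg ▸ zero_mem _)
  obtain ⟨b, hb, hbc⟩ := exists_solution_of_transcendental_constant hU E ha hg
    (hfg ▸ hc0) (hfg ▸ htr)
  have hcb : c + 1 ∈ diffAdjoin K b := by
    rw [hfg, ← hbc]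
    exact div_mem_diffAdjoin f g b
  rw [← hfg] at hbc
  have hne : a ≠ b := by
    rintro rfl
    rw [← hfg] at hbc
    exact one_ne_zero (left_eq_add.mp hbc)
  -- Otherwise `b` is in `K`, hence `K⟨b⟩ = K` contains `c + 1`.
  have hbalg : ¬ IsAlgebraic K b := by
    intro h
    obtain ⟨k, rfl⟩ := not_not.mp fun h' => transcendental_of_notMem_range h' h
    have hbot : diffAdjoin K (algebraMap K U k) ≤ ⊥ := by
      refine diffAdjoin_le K _ _ (IntermediateField.algebraMap_mem _ k) ?_
      rintro _ ⟨l, rfl⟩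
      exact ⟨Differential.deriv l, (deriv_algebraMap l).symm⟩
    obtain ⟨l, hl⟩ := hbot hcb
    exact hcK ⟨l - 1, by rw [map_sub, map_one]; exact sub_eq_of_eq_add hl⟩
  have hind := hD ![a, b]
    (by
      intro i j
      fin_cases i <;> fin_cases j <;> simp [hne, hne.symm])
    (by
      intro i
      fin_cases i
      exacts [⟨ha, halg⟩, ⟨hb, hbalg⟩])
  have h0 := isAlgebraic_of_mem_diffAdjoin (num_mem_lowerOrder E) (num_ne_zero E) ha.1 hc
  have h1 := isAlgebraic_of_mem_diffAdjoin (num_mem_lowerOrder E) (num_ne_zero E) hb.1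
    (show c ∈ diffAdjoin K b by simpa using sub_mem hcb (one_mem (diffAdjoin K b)))
  exact htr (isAlgebraic_of_algebraicIndependent hind (i := 0) (j := 1) (by decide) h0 h1)

end Constants

/-! ### Transfer to all realizations of the type -/

theorem not_isAlgebraic_of_mem_tp {K U : Type*} [Field K] [Field U] [Differential U] [Algebra K U]
    {a b : U} (hb : b ∈ tp K a) (ha : ¬ IsAlgebraic K a) : ¬ IsAlgebraic K b := by
  rintro ⟨p, hp, e⟩
  refine ha ⟨p, hp, ?_⟩
  -- Algebraicity is visible in the vanishing ideal: it is a nonzero member in `T^(0)` alone.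
  have key : ∀ x : U, Polynomial.aeval (MvPolynomial.X 0) p ∈ vanishingIdeal K x ↔
      Polynomial.aeval x p = 0 := by
    intro x
    rw [vanishingIdeal, RingHom.mem_ker, ← Polynomial.aeval_algHom_apply]
    simp [diffEval]
  rw [← key] at e ⊢
  exact hb ▸ e

theorem isSolution_of_mem_tp {K U : Type*} [Field K] [Field U] [Differential U] [Algebra K U]
    {E : DiffAlgEquation K} {a b : U} (hb : b ∈ tp K a) (ha : E.IsSolution a) :
    E.IsSolution b := by
  have key : ∀ P, diffEval K b P = 0 ↔ diffEval K a P = 0 := fun P => by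
    have := congrArg (P ∈ ·) hb
    simpa [vanishingIdeal, RingHom.mem_ker] using this
  exact ⟨(key _).mpr ha.1, fun h => ha.2 ((key _).mp h)⟩

end DiffAlg

theorem corollaryC {K : Type*} {U : Type*} [Field U] [CharZero U] [Differential U]
    (hU : DiffAlg.IsDifferentiallyClosed U)
    [Field K] [Differential K] [Algebra K U] [DifferentialAlgebra K U] [IsAlgClosed K]
    (E : DiffAlg.DiffAlgEquation K) (hirr : E.IsIrreducible) (hn : 1 ≤ E.order)
    (hD : E.PropertyD U 2) :
    ∀ p : Set U, E.IsGenericType p → DiffAlg.WeaklyOrthogonalToConstants K p := by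
  rintro _ ⟨a₀, ha₀, halg, rfl⟩ a ha
  ext x
  constructor
  · rintro ⟨hx, hx0⟩
    obtain ⟨k, rfl⟩ := DiffAlg.mem_range_of_deriv_eq_zero hU E hD
      (DiffAlg.isSolution_of_mem_tp ha ha₀) (DiffAlg.not_isAlgebraic_of_mem_tp ha halg) hx hx0
    refine ⟨k, ?_, rfl⟩
    rwa [deriv_algebraMap, map_eq_zero] at hx0
  · rintro ⟨k, hk, rfl⟩
    refine ⟨IntermediateField.algebraMap_mem _ k, ?_⟩
    rw [deriv_algebraMap, show Differential.deriv k = 0 from hk, map_zero]
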